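/- Let $d\ge 1$ and consider the Markov chain $X_t=(\xi_t,Y_t)$ on $\{0,1,2,\dots\}\times\{1,\dots,d\}$ with layers $L_n=\{n\}\times\{1,\dots,d\}$ whose transitions are state-independent off layer $0$: from $(0,i)$ it jumps to $(1,j)$ with probability $P_0(i,j)$, where $P_0$ is stochastic, and from $(n,i)$, $n\ge 1$, it jumps to $(n+1,j)$, $(n,j)$, $(n-1,j)$ with probabilities $P(i,j)$, $R(i,j)$, $Q(i,j)$, where $P,Q,R$ are nonnegative $d\times d$ matrices with $(P+Q+R)\mathbf 1=\mathbf 1$. With $\|B\|=\max_i\sum_j|B(i,j)|$, assume that $\|R+P\|<1$ and $\|R+Q\|<1$, that no column of $P_0$, $P$ or $Q$ is zero, and that all the states of layer $0$ communicate. Call layer $y$ positive recurrent if, for every initial distribution on $L_y$, the return time $T_y^+=\inf\{t\ge 1: X_t\in L_y\}$ has finite expectation; the walk is positive recurrent if its layers are. There is a stochastic matrix $\zeta^-$ with $\zeta^-=(I-P\zeta^--R)^{-1}Q$. For every such $\zeta^-$, put $$A^-=(I-P\zeta^--R)^{-1}P,\qquad \mathbf u^-=(I-P\zeta^--R)^{-1}\mathbf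 1,\qquad \bar\varrho_1^+=\mathbf 1'P\Big(\sum_{k\ge 1}(A^-)^{k-1}\mathbf u^-\Big)+d\in[0,\infty].$$ (1) The walk is positive recurrent if and only if $\bar\varrho^+_1<\infty$; more precisely, for each $y\ge 0$, layer $y$ is positive recurrent if and only if $\bar\varrho_1^+<\infty$. (2) $A^-$ has a maximal eigenvalue $\lambda_{A^-}$, that is, a real eigenvalue with $|z|\le\lambda_{A^-}$ for every complex eigenvalue $z$ of $A^-$, and $\lambda_{A^-}<1$ whenever $\bar\varrho_1^+<\infty$. -/

import Mathlib

open MeasureTheory ProbabilityTheory Matrix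
open scoped ENNReal

noncomputable section

/-- Transition blocks of a state-independent random walk on the half-strip `{0,1,2,…} × {1,…,d}`:
from layer `0` the walk moves to layer `1` according to the stochastic matrix `P₀`; from every layer
`n ≥ 1` it moves to layer `n + 1`, `n - 1`, `n` according to `P`, `Q`, `R`. -/
structure StripWalk (d : ℕ) where
  P₀ : Matrix (Fin d) (Fin d) ℝ
  P : Matrix (Fin d) (Fin d) ℝ
  Q : Matrix (Fin d) (Fin d) ℝ
  R : Matrix (Fin d) (Fin d) ℝ
  P₀_stochastic : P₀ ∈ rowStochastic ℝ (Fin d)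
  P_nonneg : ∀ i j, 0 ≤ P i j
  Q_nonneg : ∀ i j, 0 ≤ Q i j
  R_nonneg : ∀ i j, 0 ≤ R i j
  row_sum : (P + Q + R) *ᵥ 1 = 1

/-- The matrix norm `max_i ∑_j |b_ij|`. -/
def rowSumNorm {d : ℕ} (B : Matrix (Fin d) (Fin d) ℝ) : ℝ := ⨆ i, ∑ j, |B i j|

namespace StripWalk

variable {d : ℕ} (W : StripWalk d)

/-- One-step transition probabilities. The state `(n, i)` is phase `i` of layer `n`. -/
def step : ℕ × Fin d → Measure (ℕ × Fin d)
  | (0, i) => ∑ j, ENNReal.ofReal (W.P₀ i j) • Measure.dirac (1, j)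
  | (n + 1, i) => ∑ j, (ENNReal.ofReal (W.P i j) • Measure.dirac (n + 2, j)
      + ENNReal.ofReal (W.R i j) • Measure.dirac (n + 1, j)
      + ENNReal.ofReal (W.Q i j) • Measure.dirac (n, j))

theorem step_univ (x : ℕ × Fin d) : W.step x Set.univ = 1 := by
  obtain ⟨n, i⟩ := x
  cases n with
  | zero =>
    simp only [step, Measure.coe_finsetSum, Finset.sum_apply, Measure.smul_apply, measure_univ,
      smul_eq_mul, mul_one]
    rw [← ENNReal.ofReal_sum_of_nonneg
        (fun j _ => nonneg_of_mem_rowStochastic W.P₀_stochastic),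
      sum_row_of_mem_rowStochastic W.P₀_stochastic, ENNReal.ofReal_one]
  | succ n =>
    have h := congrFun W.row_sum i
    simp only [mulVec, dotProduct, Matrix.add_apply, Pi.one_apply, mul_one] at h
    simp only [step, Measure.coe_finsetSum, Finset.sum_apply, Measure.add_apply,
      Measure.smul_apply, measure_univ, smul_eq_mul, mul_one]
    rw [← ENNReal.ofReal_one, ← h, ENNReal.ofReal_sum_of_nonneg
        (fun j _ => add_nonneg (add_nonneg (W.P_nonneg i j) (W.Q_nonneg i j)) (W.R_nonneg i j))]
    refine Finset.sum_congr rfl fun j _ => ?_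
    rw [ENNReal.ofReal_add (add_nonneg (W.P_nonneg i j) (W.Q_nonneg i j)) (W.R_nonneg i j),
      ENNReal.ofReal_add (W.P_nonneg i j) (W.Q_nonneg i j)]
    ring

/-- The transition kernel of the walk. -/
def kernel : Kernel (ℕ × Fin d) (ℕ × Fin d) := Kernel.ofFunOfCountable W.step

instance : IsMarkovKernel W.kernel := ⟨fun x => ⟨W.step_univ x⟩⟩

/-- The conditional law of the position at time `n + 1` given the positions up to time `n`. -/
def historyKernel (n : ℕ) : Kernel (Finset.Iic n → ℕ × Fin d) (ℕ × Fin d) :=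
  W.kernel.comap (fun h => h ⟨n, Finset.mem_Iic.2 le_rfl⟩) (measurable_pi_apply _)

instance (n : ℕ) : IsMarkovKernel (W.historyKernel n) := by
  unfold historyKernel; infer_instance

/-- The law of the trajectory `X₀, X₁, X₂, …` of the walk started in layer `y` with phase
distribution `μ`. -/
def law (y : ℕ) (μ : PMF (Fin d)) : Measure (ℕ → ℕ × Fin d) :=
  Kernel.trajMeasure (X := fun _ => ℕ × Fin d) (μ.toMeasure.map fun i => (y, i)) W.historyKernel

/-- Conditions on the walk: `‖R + P‖ < 1` and `‖R + Q‖ < 1` (that is, `log (1 - ‖·‖)⁻¹ < ∞`); no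
column of `P₀`, `P` or `Q` vanishes; all states of layer `0` communicate. -/
structure ConditionC : Prop where
  norm_RP : rowSumNorm (W.R + W.P) < 1
  norm_RQ : rowSumNorm (W.R + W.Q) < 1
  col_P₀ : ∀ j, 0 < ∑ i, W.P₀ i j
  col_P : ∀ j, 0 < ∑ i, W.P i j
  col_Q : ∀ j, 0 < ∑ i, W.Q i j
  layer_zero : ∀ i j : Fin d, Relation.ReflTransGen (fun x y => 0 < W.step x {y}) (0, i) (0, j)

/-- `ζ` is a stochastic matrix with `ζ = (I - Pζ - R)⁻¹ Q`. -/
def IsExitMatrix (ζ : Matrix (Fin d) (Fin d) ℝ) : Prop :=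
  ζ ∈ rowStochastic ℝ (Fin d) ∧ ζ = (1 - W.P * ζ - W.R)⁻¹ * W.Q

/-- `A⁻ = (I - Pζ - R)⁻¹ P`. -/
def Aminus (ζ : Matrix (Fin d) (Fin d) ℝ) : Matrix (Fin d) (Fin d) ℝ :=
  (1 - W.P * ζ - W.R)⁻¹ * W.P

/-- `u⁻ = (I - Pζ - R)⁻¹ 𝟏`. -/
def uminus (ζ : Matrix (Fin d) (Fin d) ℝ) : Fin d → ℝ :=
  (1 - W.P * ζ - W.R)⁻¹ *ᵥ 1

/-- `𝟏' P (∑_{k ≥ 1} (A⁻)^(k-1) u⁻) + d`, as an element of `[0, ∞]` (all the terms are nonnegative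
for the walks considered; the summation index below is `k - 1`). -/
def rhoBar (ζ : Matrix (Fin d) (Fin d) ℝ) : ℝ≥0∞ :=
  (∑ i, ∑ j, ENNReal.ofReal (W.P i j) *
    (∑' k : ℕ, ENNReal.ofReal (((W.Aminus ζ ^ k) *ᵥ W.uminus ζ) j))) + d

end StripWalk

/-- `T_y⁺ = inf {t ≥ 1 : X_t ∈ L_y}`, with value `∞` if layer `y` is never visited after time `0`. -/
def returnTime {d : ℕ} (y : ℕ) (ω : ℕ → ℕ × Fin d) : ℝ≥0∞ :=
  ⨅ (t : ℕ) (_ : 1 ≤ t ∧ (ω t).1 = y), (t : ℝ≥0∞)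

/-- Layer `y` is positive recurrent: started in layer `y`, with any distribution on it, the walk has
a return time to layer `y` of finite expectation. -/
def StripWalk.LayerPositiveRecurrent {d : ℕ} (W : StripWalk d) (y : ℕ) : Prop :=
  ∀ μ : PMF (Fin d), ∫⁻ ω, returnTime y ω ∂(W.law y μ) < ∞

/-- `r` is the maximal eigenvalue of the real matrix `A`: an eigenvalue whose value is at least the
modulus of every complex eigenvalue of `A`. -/
def IsMaximalEigenvalue {d : ℕ} (A : Matrix (Fin d) (Fin d) ℝ) (r : ℝ) : Prop :=
  Module.End.HasEigenvalue (Matrix.toLin' A) r ∧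
    ∀ z : ℂ, Module.End.HasEigenvalue (Matrix.toLin' (A.map Complex.ofReal)) z → ‖z‖ ≤ r

end

/-! The mean return time to a layer is the sum over `t` of the probabilities of avoiding it up to
time `t`. Its truncations `meanAvoid` obey a first-step recursion, so every supersolution `1 +
killed f ≤ f` dominates them (`meanAvoid_le`).

Off layer `0` the walk is homogeneous. Heuristically, the mean time `v` of descent by one layer
solves `v = 1 + P(v + ζv) + Rv`, with `ζ` the phase law on arrival; equivalently `v = u⁻ + A⁻v`,
with Neumann series `∑ (A⁻)^k u⁻`. As no column of `P` vanishes, `rhoBar` is finite exactly when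
this series converges.

If it converges, descent times above layer `y`, glued to a geometric bound on ascent times below it,
form a supersolution. Conversely, a finite mean return time bounds the truncated descent times;
their limit `v` satisfies `u⁻ + A⁻v ≤ v`, which bounds every partial sum. For an arbitrary exit
matrix `ζ` this needs `tendsto_firstPassage_one`: the first-passage matrices lie below `ζ` and lose
no mass in the limit.

An exit matrix exists because a substochastic solution of `G = PG² + RG + Q` becomes stochastic
after adding a rank-one term built from a left Perron vector. The maximal eigenvalue `r` of `A⁻` has
a nonnegative eigenvector `x ≤ u⁻`, so convergence of the series forces `r^k x → 0`. -/

noncomputable section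

/-! ### Mean return times through the killed transition operator -/

namespace StripWalk

variable {d : ℕ} (W : StripWalk d)

/-- The transition operator of the walk killed upon entering layer `y`. -/
def killed (y : ℕ) (f : ℕ × Fin d → ℝ≥0∞) (x : ℕ × Fin d) : ℝ≥0∞ :=
  ∫⁻ x', (if x'.1 = y then 0 else f x') ∂(W.step x)

/-- The event of not visiting layer `y` at the times `1, …, t`. -/
def avoids (y t : ℕ) : Set (ℕ → ℕ × Fin d) := {ω | ∀ s, 1 ≤ s → s ≤ t → (ω s).1 ≠ y}

theorem avoids_succ (y t : ℕ) :
    (avoids y (t + 1) : Set (ℕ → ℕ × Fin d)) = {ω | ω ∈ avoids y t ∧ (ω (t + 1)).1 ≠ y} := by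
  ext ω
  constructor
  · exact fun h => ⟨fun s h1 h2 => h s h1 (by omega), h _ (by omega) le_rfl⟩
  · rintro ⟨h, h'⟩ s h1 h2
    rcases Nat.lt_or_ge t s with h3 | h3
    · obtain rfl : s = t + 1 := by omega
      exact h'
    · exact h s h1 h3

theorem measurableSet_avoids (y t : ℕ) :
    MeasurableSet (avoids y t : Set (ℕ → ℕ × Fin d)) := by
  have : (avoids y t : Set (ℕ → ℕ × Fin d)) =
      ⋂ s : ℕ, ⋂ _ : 1 ≤ s, ⋂ _ : s ≤ t, (fun ω => ω s) ⁻¹' {x | x.1 ≠ y} := by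
    ext ω; simp [avoids]
  rw [this]
  exact MeasurableSet.iInter fun s => MeasurableSet.iInter fun _ => MeasurableSet.iInter fun _ =>
    measurable_pi_apply s (Set.to_countable _).measurableSet

variable (y : ℕ) (μ : PMF (Fin d))

theorem lintegral_law_zero (f : ℕ × Fin d → ℝ≥0∞) :
    ∫⁻ ω, f (ω 0) ∂(W.law y μ) = ∑ i, μ i * f (y, i) := by
  have h0 : (W.law y μ).map (fun ω => ω 0) = μ.toMeasure.map fun i => (y, i) := by
    have h1 : (W.law y μ).map (Preorder.frestrictLe 0) =
        (μ.toMeasure.map fun i => (y, i)).map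
          (MeasurableEquiv.piUnique (fun _ : Finset.Iic 0 => ℕ × Fin d)).symm := by
      rw [law, Kernel.trajMeasure, Measure.map_comp _ _ (by fun_prop),
        Kernel.traj_map_frestrictLe, Kernel.partialTraj_self, Measure.id_comp]
    have h2 : (fun ω : ℕ → ℕ × Fin d => ω 0) =
        (MeasurableEquiv.piUnique (fun _ : Finset.Iic 0 => ℕ × Fin d)) ∘
          (Preorder.frestrictLe 0) := rfl
    rw [h2, ← Measure.map_map (by fun_prop) (by fun_prop), h1,
      Measure.map_map (by fun_prop) (by fun_prop), MeasurableEquiv.self_comp_symm, Measure.map_id]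
  have hm : Measurable f := Measurable.of_discrete
  rw [← lintegral_map (g := fun ω : ℕ → ℕ × Fin d => ω 0) hm (measurable_pi_apply 0), h0,
    lintegral_map hm (Measurable.of_discrete), lintegral_fintype]
  simp [mul_comm]

/-- The one-step Markov property: the joint law of the history up to `t` and the next position is a
composition product with `historyKernel`, which reads only the last position. -/
theorem lintegral_law_succ (t : ℕ) (F : (Finset.Iic t → ℕ × Fin d) → ℝ≥0∞)
    (f : ℕ × Fin d → ℝ≥0∞) :
    ∫⁻ ω, F (Preorder.frestrictLe t ω) * f (ω (t + 1)) ∂(W.law y μ) =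
      ∫⁻ ω, F (Preorder.frestrictLe t ω) * (∫⁻ x, f x ∂(W.step (ω t))) ∂(W.law y μ) := by
  have hμ : IsProbabilityMeasure (μ.toMeasure.map fun i => (y, i)) :=
    Measure.isProbabilityMeasure_map (Measurable.of_discrete).aemeasurable
  have h := Kernel.map_frestrictLe_trajMeasure_compProd_eq_map_trajMeasure
    (X := fun _ => ℕ × Fin d) (μ₀ := μ.toMeasure.map fun i => (y, i)) (κ := W.historyKernel)
    (a := t)
  have hF : Measurable F := Measurable.of_discrete
  have hf : Measurable f := Measurable.of_discrete
  have hg : Measurable fun p : (Finset.Iic t → ℕ × Fin d) × (ℕ × Fin d) => F p.1 * f p.2 := by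
    fun_prop
  have h1 : ∫⁻ ω, F (Preorder.frestrictLe t ω) * f (ω (t + 1)) ∂(W.law y μ) =
      ∫⁻ p, F p.1 * f p.2 ∂((W.law y μ).map
        (fun x ↦ (Preorder.frestrictLe t x, x (t + 1)))) :=
    (lintegral_map (g := fun x : ℕ → ℕ × Fin d => (Preorder.frestrictLe t x, x (t + 1)))
      hg (by fun_prop)).symm
  have h' : (W.law y μ).map (fun x ↦ (Preorder.frestrictLe t x, x (t + 1))) =
    (W.law y μ).map (Preorder.frestrictLe t) ⊗ₘ W.historyKernel t := h.symm
  have : IsProbabilityMeasure (W.law y μ) := by unfold law; infer_instance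
  rw [h1, h', Measure.lintegral_compProd hg, lintegral_map (Measurable.of_discrete)
    (by fun_prop)]
  refine lintegral_congr fun ω => ?_
  change ∫⁻ x, F (Preorder.frestrictLe t ω) * f x ∂(W.step (ω t)) = _
  exact lintegral_const_mul _ hf

theorem lintegral_avoids (t : ℕ) (f : ℕ × Fin d → ℝ≥0∞) :
    ∫⁻ ω, (avoids y t).indicator 1 ω * f (ω t) ∂(W.law y μ) =
      ∑ i, μ i * (W.killed y)^[t] f (y, i) := by
  induction t generalizing f with
  | zero =>
    have : ∀ ω : ℕ → ℕ × Fin d, ω ∈ avoids y 0 := fun ω s h1 h2 => by omega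
    simp only [Set.indicator_of_mem (this _), Pi.one_apply, one_mul, Function.iterate_zero, id]
    exact W.lintegral_law_zero y μ f
  | succ t ih =>
    rw [Function.iterate_succ_apply, ← ih]
    classical
    set F : (Finset.Iic t → ℕ × Fin d) → ℝ≥0∞ := fun h =>
      if ∀ s : Finset.Iic t, 1 ≤ s.1 → (h s).1 ≠ y then 1 else 0 with hF
    have hF' : ∀ ω : ℕ → ℕ × Fin d, (avoids y t).indicator 1 ω = F (Preorder.frestrictLe t ω) := by
      intro ω
      have : ω ∈ avoids y t ↔ ∀ s : Finset.Iic t, 1 ≤ s.1 → (ω s).1 ≠ y :=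
        ⟨fun h s h1 => h s h1 (Finset.mem_Iic.1 s.2),
          fun h s h1 h2 => h ⟨s, Finset.mem_Iic.2 h2⟩ h1⟩
      rw [Set.indicator_apply]
      exact if_congr this rfl rfl
    have h1 : ∀ ω : ℕ → ℕ × Fin d, (avoids y (t + 1)).indicator 1 ω * f (ω (t + 1)) =
        F (Preorder.frestrictLe t ω) * (if (ω (t + 1)).1 = y then 0 else f (ω (t + 1))) := by
      intro ω
      rw [← hF', avoids_succ]
      by_cases h1 : ω ∈ avoids y t <;> by_cases h2 : (ω (t + 1)).1 = y <;>
        simp [h1, h2]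
    simp only [h1, hF']
    exact W.lintegral_law_succ y μ t F (fun x => if x.1 = y then 0 else f x)

/-- Tail-sum formula: the term at `t` is the indicator of a return time exceeding `t`, and the term
at `t = 0` is always `1`. -/
theorem returnTime_eq_tsum (ω : ℕ → ℕ × Fin d) :
    returnTime y ω = ∑' t, (avoids y t).indicator 1 ω := by
  classical
  by_cases h : ∃ t, 1 ≤ t ∧ (ω t).1 = y
  · have hspec := Nat.find_spec h
    have hmin := fun s => Nat.find_min h (m := s)
    set T := Nat.find h
    have h1 : returnTime y ω = T := by
      refine le_antisymm (iInf₂_le T hspec) (le_iInf₂ fun t ht => ?_)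
      exact_mod_cast Nat.find_min' h ht
    have h2 : ∀ t, (avoids y t).indicator (1 : (ℕ → ℕ × Fin d) → ℝ≥0∞) ω =
        if t ∈ Finset.range T then 1 else 0 := by
      intro t
      have : ω ∈ avoids y t ↔ t < T := by
        refine ⟨fun ha => ?_, fun ht s h1 h2 h3 => hmin s (by omega) ⟨h1, h3⟩⟩
        by_contra hlt
        exact ha T hspec.1 (by omega) hspec.2
      simp [Set.indicator_apply, this]
    rw [h1, tsum_congr h2, tsum_eq_sum (s := Finset.range T)]
    · rw [Finset.sum_congr rfl fun t ht => if_pos ht]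
      simp
    · exact fun t ht => if_neg ht
  · have h1 : returnTime y ω = ∞ := by
      simp only [returnTime, iInf_eq_top]
      exact fun t ht => absurd ⟨t, ht⟩ h
    have h2 : ∀ t, (avoids y t).indicator (1 : (ℕ → ℕ × Fin d) → ℝ≥0∞) ω = 1 := by
      intro t
      have : ω ∈ avoids y t := fun s h1 h2 h3 => h ⟨s, h1, h3⟩
      simp [this]
    rw [h1, tsum_congr h2, ENNReal.tsum_const_eq_top_of_ne_zero one_ne_zero]

/-- The mean number of steps, among the first `T`, before the walk enters layer `y`. -/
def meanAvoid (y T : ℕ) (x : ℕ × Fin d) : ℝ≥0∞ := ∑ t ∈ Finset.range T, (W.killed y)^[t] 1 x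

theorem lintegral_returnTime :
    ∫⁻ ω, returnTime y ω ∂(W.law y μ) = ⨆ T, ∑ i, μ i * W.meanAvoid y T (y, i) := by
  simp only [returnTime_eq_tsum]
  rw [lintegral_tsum fun t => (measurable_one.indicator (measurableSet_avoids y t)).aemeasurable,
    ENNReal.tsum_eq_iSup_nat]
  refine iSup_congr fun T => ?_
  simp only [meanAvoid, Finset.mul_sum]
  rw [Finset.sum_comm]
  refine Finset.sum_congr rfl fun t _ => ?_
  rw [← W.lintegral_avoids y μ t 1]
  simp

theorem killed_sum (s : Finset ℕ) (f : ℕ → ℕ × Fin d → ℝ≥0∞) (x : ℕ × Fin d) :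
    W.killed y (fun x' => ∑ t ∈ s, f t x') x = ∑ t ∈ s, W.killed y (f t) x := by
  simp only [killed]
  rw [← lintegral_finsetSum _ fun _ _ => Measurable.of_discrete]
  refine lintegral_congr fun x' => ?_
  split_ifs <;> simp

theorem meanAvoid_zero (x : ℕ × Fin d) : W.meanAvoid y 0 x = 0 := by simp [meanAvoid]

theorem meanAvoid_succ (T : ℕ) (x : ℕ × Fin d) :
    W.meanAvoid y (T + 1) x = 1 + W.killed y (W.meanAvoid y T) x := by
  have h : W.meanAvoid y T = fun x' => ∑ t ∈ Finset.range T, (W.killed y)^[t] 1 x' := rfl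
  rw [meanAvoid, Finset.sum_range_succ', h, W.killed_sum, add_comm]
  simp [Function.iterate_succ_apply']

theorem killed_mono {f g : ℕ × Fin d → ℝ≥0∞} (h : ∀ x, x.1 ≠ y → f x ≤ g x) (x : ℕ × Fin d) :
    W.killed y f x ≤ W.killed y g x := by
  refine lintegral_mono fun x' => ?_
  dsimp only
  split_ifs with hx
  · exact le_rfl
  · exact h x' hx

theorem meanAvoid_le {f : ℕ × Fin d → ℝ≥0∞} (hf : ∀ x, 1 + W.killed y f x ≤ f x) (T : ℕ) :
    W.meanAvoid y T ≤ f := by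
  induction T with
  | zero => intro x; simp [meanAvoid_zero]
  | succ T ih =>
    intro x
    rw [meanAvoid_succ]
    exact (add_le_add_right (W.killed_mono y (fun x' _ => ih x') x) 1).trans (hf x)

theorem killed_zero (f : ℕ × Fin d → ℝ≥0∞) (i : Fin d) :
    W.killed y f (0, i) =
      ∑ j, ENNReal.ofReal (W.P₀ i j) * (if 1 = y then 0 else f (1, j)) := by
  simp [killed, step, lintegral_finsetSum_measure, lintegral_smul_measure]

theorem killed_succ (f : ℕ × Fin d → ℝ≥0∞) (n : ℕ) (i : Fin d) :
    W.killed y f (n + 1, i) =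
      ∑ j, (ENNReal.ofReal (W.P i j) * (if n + 2 = y then 0 else f (n + 2, j)) +
        ENNReal.ofReal (W.R i j) * (if n + 1 = y then 0 else f (n + 1, j)) +
        ENNReal.ofReal (W.Q i j) * (if n = y then 0 else f (n, j))) := by
  simp [killed, step, lintegral_finsetSum_measure, lintegral_smul_measure]

theorem layerPositiveRecurrent_of_supersolution {f : ℕ × Fin d → ℝ≥0∞}
    (hf : ∀ x, 1 + W.killed y f x ≤ f x) (hfin : ∀ i, f (y, i) < ∞) :
    W.LayerPositiveRecurrent y := by
  intro μ
  rw [W.lintegral_returnTime]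
  refine (iSup_le fun T => Finset.sum_le_sum fun i _ =>
    mul_le_mul_right (W.meanAvoid_le y hf T (y, i)) (μ i)).trans_lt ?_
  exact ENNReal.sum_lt_top.2 fun i _ => ENNReal.mul_lt_top (μ.apply_lt_top i) (hfin i)

theorem LayerPositiveRecurrent.exists_bound {y : ℕ} (h : W.LayerPositiveRecurrent y) (i : Fin d) :
    ∃ C < ∞, ∀ T, W.meanAvoid y T (y, i) ≤ C := by
  refine ⟨_, h (PMF.pure i), fun T => ?_⟩
  rw [W.lintegral_returnTime]
  refine le_iSup_of_le T ?_
  simp [PMF.pure_apply]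

end StripWalk

/-! ### Perron–Frobenius theory -/

/-- The set of Collatz–Wielandt pairs of a matrix. -/
def collatzWielandt {d : ℕ} (A : Matrix (Fin d) (Fin d) ℝ) : Set (ℝ × (Fin d → ℝ)) :=
  {p | 0 ≤ p.1 ∧ p.2 ∈ stdSimplex ℝ (Fin d) ∧ p.1 • p.2 ≤ A *ᵥ p.2}

theorem sum_mulVec_le {d : ℕ} {A : Matrix (Fin d) (Fin d) ℝ} (hA : ∀ i j, 0 ≤ A i j)
    {x : Fin d → ℝ} (hx : x ∈ stdSimplex ℝ (Fin d)) :
    ∑ i, (A *ᵥ x) i ≤ ∑ i, ∑ j, A i j := by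
  simp only [mulVec, dotProduct]
  refine Finset.sum_le_sum fun i _ => Finset.sum_le_sum fun j _ => ?_
  have h1 : x j ≤ 1 := hx.2 ▸ Finset.single_le_sum (fun k _ => hx.1 k) (Finset.mem_univ j)
  exact mul_le_of_le_one_right (hA i j) h1

theorem le_of_smul_le_mulVec {d : ℕ} {A : Matrix (Fin d) (Fin d) ℝ} (hA : ∀ i j, 0 ≤ A i j)
    {s : ℝ} {x : Fin d → ℝ} (hx : x ∈ stdSimplex ℝ (Fin d)) (h : s • x ≤ A *ᵥ x) :
    s ≤ ∑ i, ∑ j, A i j := by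
  refine le_trans ?_ (sum_mulVec_le hA hx)
  calc s = ∑ i, (s • x) i := by simp [← Finset.mul_sum, hx.2]
    _ ≤ _ := Finset.sum_le_sum fun i _ => h i

theorem isCompact_collatzWielandt {d : ℕ} {A : Matrix (Fin d) (Fin d) ℝ}
    (hA : ∀ i j, 0 ≤ A i j) : IsCompact (collatzWielandt A) := by
  refine ((isCompact_Icc (a := (0 : ℝ)) (b := ∑ i, ∑ j, A i j)).prod
    (isCompact_stdSimplex ℝ (Fin d))).of_isClosed_subset ?_ ?_
  · have hc : IsClosed {p : ℝ × (Fin d → ℝ) | p.1 • p.2 ≤ A *ᵥ p.2} :=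
      isClosed_le (by fun_prop) (Continuous.matrix_mulVec continuous_const continuous_snd)
    exact (isClosed_le continuous_const continuous_fst).inter
      (((isClosed_stdSimplex ℝ (Fin d)).preimage continuous_snd).inter hc)
  · rintro ⟨s, x⟩ ⟨h0, hx, h⟩
    exact ⟨⟨h0, le_of_smul_le_mulVec hA hx h⟩, hx⟩

theorem mulVec_nonneg_of_nonneg {d : ℕ} {A : Matrix (Fin d) (Fin d) ℝ} (hA : ∀ i j, 0 ≤ A i j)
    {x : Fin d → ℝ} (hx : 0 ≤ x) : 0 ≤ A *ᵥ x := by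
  intro i
  simp only [mulVec, dotProduct, Pi.zero_apply]
  exact Finset.sum_nonneg fun j _ => mul_nonneg (hA i j) (hx j)

theorem mulVec_mono_of_nonneg {d : ℕ} {A : Matrix (Fin d) (Fin d) ℝ} (hA : ∀ i j, 0 ≤ A i j)
    {x y : Fin d → ℝ} (h : x ≤ y) : A *ᵥ x ≤ A *ᵥ y := by
  intro i
  simp only [mulVec, dotProduct]
  exact Finset.sum_le_sum fun j _ => mul_le_mul_of_nonneg_left (h j) (hA i j)

theorem mulVec_pos_of_pos {d : ℕ} {A : Matrix (Fin d) (Fin d) ℝ} (hA : ∀ i j, 0 < A i j)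
    {x : Fin d → ℝ} (hx : 0 ≤ x) (h0 : x ≠ 0) (i : Fin d) : 0 < (A *ᵥ x) i := by
  obtain ⟨j, hj⟩ := Function.ne_iff.1 h0
  exact Finset.sum_pos' (fun j _ => mul_nonneg (hA i j).le (hx j))
    ⟨j, Finset.mem_univ j, mul_pos (hA i j) (lt_of_le_of_ne (hx j) (Ne.symm hj))⟩

theorem normalize_mem_stdSimplex {d : ℕ} {x : Fin d → ℝ} (hx : 0 ≤ x) (h0 : x ≠ 0) :
    0 < ∑ i, x i ∧ (∑ i, x i)⁻¹ • x ∈ stdSimplex ℝ (Fin d) := by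
  obtain ⟨j, hj⟩ := Function.ne_iff.1 h0
  have hs : 0 < ∑ i, x i := Finset.sum_pos' (fun j _ => hx j)
    ⟨j, Finset.mem_univ j, lt_of_le_of_ne (hx j) (Ne.symm hj)⟩
  refine ⟨hs, fun i => mul_nonneg (inv_nonneg.2 hs.le) (hx i), ?_⟩
  simp only [Pi.smul_apply, smul_eq_mul, ← Finset.mul_sum]
  exact inv_mul_cancel₀ hs.ne'

theorem ne_zero_of_mem_stdSimplex {d : ℕ} {x : Fin d → ℝ} (hx : x ∈ stdSimplex ℝ (Fin d)) :
    x ≠ 0 := by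
  rintro rfl
  simpa using hx.2

theorem uniform_mem_stdSimplex {d : ℕ} (hd : 0 < d) :
    (fun _ => (d : ℝ)⁻¹) ∈ stdSimplex ℝ (Fin d) := by
  refine ⟨fun _ => by positivity, ?_⟩
  have : (d : ℝ) ≠ 0 := by positivity
  simp [this]

/-- The Perron–Frobenius theorem for positive matrices, with the Collatz–Wielandt bound. -/
theorem exists_perron_of_pos {d : ℕ} (hd : 0 < d) {A : Matrix (Fin d) (Fin d) ℝ}
    (hA : ∀ i j, 0 < A i j) :
    ∃ r : ℝ, 0 ≤ r ∧ ∃ x ∈ stdSimplex ℝ (Fin d), A *ᵥ x = r • x ∧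
      ∀ (s : ℝ) (y : Fin d → ℝ), 0 ≤ y → y ≠ 0 → s • y ≤ A *ᵥ y → s ≤ r := by
  have hA' : ∀ i j, 0 ≤ A i j := fun i j => (hA i j).le
  have hne : (collatzWielandt A).Nonempty :=
    ⟨(0, fun _ => (d : ℝ)⁻¹), le_rfl, uniform_mem_stdSimplex hd, by
      simpa using mulVec_nonneg_of_nonneg hA' (uniform_mem_stdSimplex hd).1⟩
  obtain ⟨⟨r, x⟩, ⟨hr, hx, hrx⟩, hmax⟩ :=
    (isCompact_collatzWielandt hA').exists_isMaxOn hne continuous_fst.continuousOn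
  simp only at hr hx hrx
  have hbound : ∀ (s : ℝ) (y : Fin d → ℝ), 0 ≤ y → y ≠ 0 → s • y ≤ A *ᵥ y → s ≤ r := by
    intro s y hy h0 hs
    rcases lt_or_ge s 0 with h | h
    · exact h.le.trans hr
    obtain ⟨hpos, hmem⟩ := normalize_mem_stdSimplex hy h0
    refine hmax (show (s, (∑ i, y i)⁻¹ • y) ∈ collatzWielandt A from ⟨h, hmem, ?_⟩)
    simp only [mulVec_smul, smul_comm s]
    exact smul_le_smul_of_nonneg_left hs (inv_nonneg.2 hpos.le)
  refine ⟨r, hr, x, hx, ?_, hbound⟩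
  by_contra hne
  have hx0 := ne_zero_of_mem_stdSimplex hx
  -- Were `r • x ≤ A *ᵥ x` not an equality, applying the positive matrix `A` would make it strict
  -- everywhere, and `A *ᵥ x` would achieve a ratio `r + δ`, against the maximality of `r`.
  set y := A *ᵥ x with hy
  have hypos := mulVec_pos_of_pos hA hx.1 hx0
  have hzpos := mulVec_pos_of_pos hA (sub_nonneg.2 hrx) (sub_ne_zero.2 hne)
  have : Nonempty (Fin d) := ⟨⟨0, hd⟩⟩
  obtain ⟨i₀, hi₀⟩ := Finite.exists_min fun i => (A *ᵥ (y - r • x)) i / y i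
  set δ := (A *ᵥ (y - r • x)) i₀ / y i₀
  have hδ : 0 < δ := div_pos (hzpos i₀) (hypos i₀)
  have := hbound (r + δ) y (fun i => (hypos i).le) (fun h => (hypos i₀).ne' (congrFun h i₀)) ?_
  · linarith
  · intro i
    have h1 := hi₀ i
    rw [le_div_iff₀ (hypos i), mulVec_sub, mulVec_smul, ← hy] at h1
    simp only [Pi.sub_apply, Pi.smul_apply, smul_eq_mul] at h1 ⊢
    linarith

theorem tendsto_mulVec {d : ℕ} {B : ℕ → Matrix (Fin d) (Fin d) ℝ} {A : Matrix (Fin d) (Fin d) ℝ}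
    {x : ℕ → Fin d → ℝ} {x' : Fin d → ℝ} (hB : Filter.Tendsto B Filter.atTop (nhds A))
    (hx : Filter.Tendsto x Filter.atTop (nhds x')) :
    Filter.Tendsto (fun n => B n *ᵥ x n) Filter.atTop (nhds (A *ᵥ x')) := by
  have hc : Continuous fun p : Matrix (Fin d) (Fin d) ℝ × (Fin d → ℝ) => p.1 *ᵥ p.2 :=
    continuous_fst.matrix_mulVec continuous_snd
  exact (hc.tendsto (A, x')).comp (hB.prodMk_nhds hx)

/-- The Perron–Frobenius theorem for nonnegative matrices, with the Collatz–Wielandt bound. -/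
theorem exists_perron {d : ℕ} (hd : 0 < d) {A : Matrix (Fin d) (Fin d) ℝ}
    (hA : ∀ i j, 0 ≤ A i j) :
    ∃ r : ℝ, 0 ≤ r ∧ ∃ x ∈ stdSimplex ℝ (Fin d), A *ᵥ x = r • x ∧
      ∀ (s : ℝ) (y : Fin d → ℝ), 0 ≤ y → y ≠ 0 → s • y ≤ A *ᵥ y → s ≤ r := by
  -- Positive perturbations decreasing to `A`; compactness extracts a limiting eigenpair, and the
  -- bound survives because `A ≤ B n`.
  set B : ℕ → Matrix (Fin d) (Fin d) ℝ := fun n => A + (1 / ((n : ℝ) + 1)) • Matrix.of 1 with hB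
  have hBA : ∀ n i j, A i j < B n i j := fun n i j => by
    have : 0 < 1 / ((n : ℝ) + 1) := by positivity
    simp [hB]; positivity
  have hB1 : ∀ n i j, B n i j ≤ A i j + 1 := fun n i j => by
    have : 1 / ((n : ℝ) + 1) ≤ 1 := by
      rw [div_le_one (by positivity)]; linarith [(Nat.cast_nonneg n : (0 : ℝ) ≤ n)]
    simpa [hB] using this
  have hB0 : ∀ n i j, 0 < B n i j := fun n i j => (hA i j).trans_lt (hBA n i j)
  choose r hr x hx hrx hmax using fun n => exists_perron_of_pos hd (hB0 n)
  have hmem : ∀ n, (r n, x n) ∈ Set.Icc (0 : ℝ) (∑ i, ∑ j, (A i j + 1)) ×ˢ stdSimplex ℝ (Fin d) :=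
    fun n => ⟨⟨hr n, (le_of_smul_le_mulVec (fun i j => (hB0 n i j).le) (hx n) (hrx n).ge).trans
      (Finset.sum_le_sum fun i _ => Finset.sum_le_sum fun j _ => hB1 n i j)⟩, hx n⟩
  obtain ⟨⟨r', x'⟩, ⟨hr', hx'⟩, φ, hφ, hlim⟩ :=
    (isCompact_Icc.prod (isCompact_stdSimplex ℝ (Fin d))).tendsto_subseq hmem
  have hlr : Filter.Tendsto (fun n => r (φ n)) Filter.atTop (nhds r') :=
    (continuous_fst.tendsto _).comp hlim
  have hlx : Filter.Tendsto (fun n => x (φ n)) Filter.atTop (nhds x') :=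
    (continuous_snd.tendsto _).comp hlim
  have hlB : Filter.Tendsto (fun n => B (φ n)) Filter.atTop (nhds A) := by
    have : Filter.Tendsto B Filter.atTop (nhds (A + (0 : ℝ) • Matrix.of 1)) :=
      tendsto_const_nhds.add (tendsto_one_div_add_atTop_nhds_zero_nat.smul_const _)
    simpa [Function.comp_def] using this.comp hφ.tendsto_atTop
  refine ⟨r', hr'.1, x', hx', ?_, fun s y hy h0 hs => ?_⟩
  · have h1 := tendsto_mulVec hlB hlx
    simp only [hrx] at h1
    exact tendsto_nhds_unique h1 (hlr.smul hlx)
  · refine ge_of_tendsto' hlr fun n => hmax (φ n) s y hy h0 (hs.trans fun i => ?_)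
    simp only [mulVec, dotProduct]
    exact Finset.sum_le_sum fun j _ => mul_le_mul_of_nonneg_right (hBA _ i j).le (hy j)

/-- A nonnegative matrix has a maximal eigenvalue, with a nonnegative eigenvector. -/
theorem exists_isMaximalEigenvalue {d : ℕ} (hd : 0 < d) {A : Matrix (Fin d) (Fin d) ℝ}
    (hA : ∀ i j, 0 ≤ A i j) :
    ∃ r : ℝ, IsMaximalEigenvalue A r ∧ 0 ≤ r ∧ ∃ x ∈ stdSimplex ℝ (Fin d), A *ᵥ x = r • x := by
  obtain ⟨r, hr, x, hx, hrx, hmax⟩ := exists_perron hd hA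
  refine ⟨r, ⟨Module.End.hasEigenvalue_of_hasEigenvector (x := x)
    ⟨Module.End.mem_eigenspace_iff.2 (by simpa using hrx), ne_zero_of_mem_stdSimplex hx⟩, ?_⟩,
    hr, x, hx, hrx⟩
  intro z hz
  obtain ⟨v, hv⟩ := hz.exists_hasEigenvector
  have hv1 : A.map Complex.ofReal *ᵥ v = z • v := by simpa using hv.apply_eq_smul
  -- The entrywise moduli of a complex eigenvector form a test vector: `‖z‖ |v| ≤ A |v|` by the
  -- triangle inequality.
  refine hmax ‖z‖ (fun i => ‖v i‖) (fun i => norm_nonneg _) ?_ fun i => ?_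
  · intro h
    exact hv.2 (funext fun i => norm_eq_zero.1 (congrFun h i))
  · have h := congrArg norm (congrFun hv1 i)
    simp only [Pi.smul_apply, smul_eq_mul, norm_mul] at h ⊢
    rw [← h]
    simp only [mulVec, dotProduct]
    refine (norm_sum_le _ _).trans (Finset.sum_le_sum fun j _ => ?_)
    simp [abs_of_nonneg (hA i j)]

/-! ### Inverses of `1 - B` for strictly substochastic `B` -/

section Substochastic

variable {d : ℕ} {B : Matrix (Fin d) (Fin d) ℝ}

/-- The minimum principle for `1 - B`, where `B` is strictly substochastic. -/
theorem nonneg_of_one_sub_mulVec_nonneg (hB : ∀ i j, 0 ≤ B i j) (hs : ∀ i, ∑ j, B i j < 1)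
    {x : Fin d → ℝ} (h : 0 ≤ (1 - B) *ᵥ x) : 0 ≤ x := by
  rcases isEmpty_or_nonempty (Fin d) with he | he
  · exact fun i => he.elim i
  obtain ⟨i₀, hi₀⟩ := Finite.exists_min x
  have h1 := h i₀
  simp only [sub_mulVec, one_mulVec, Pi.zero_apply, Pi.sub_apply] at h1
  have h2 : (∑ j, B i₀ j) * x i₀ ≤ (B *ᵥ x) i₀ := by
    rw [Finset.sum_mul]
    exact Finset.sum_le_sum fun j _ => mul_le_mul_of_nonneg_left (hi₀ j) (hB i₀ j)
  have h3 : 0 ≤ x i₀ := by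
    by_contra h4
    nlinarith [hs i₀]
  exact fun i => h3.trans (hi₀ i)

theorem isUnit_one_sub_of_sum_lt_one (hB : ∀ i j, 0 ≤ B i j) (hs : ∀ i, ∑ j, B i j < 1) :
    IsUnit (1 - B) := by
  rw [← mulVec_injective_iff_isUnit]
  have key : ∀ x y : Fin d → ℝ, (1 - B) *ᵥ x = (1 - B) *ᵥ y → x ≤ y := fun x y hxy =>
    sub_nonneg.1 (nonneg_of_one_sub_mulVec_nonneg hB hs (by rw [mulVec_sub, hxy, sub_self]))
  exact fun x y hxy => le_antisymm (key x y hxy) (key y x hxy.symm)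

theorem one_sub_mul_inv (hB : ∀ i j, 0 ≤ B i j) (hs : ∀ i, ∑ j, B i j < 1) :
    (1 - B) * (1 - B)⁻¹ = 1 :=
  mul_nonsing_inv _ ((isUnit_iff_isUnit_det _).1 (isUnit_one_sub_of_sum_lt_one hB hs))

theorem inv_one_sub_mul (hB : ∀ i j, 0 ≤ B i j) (hs : ∀ i, ∑ j, B i j < 1) :
    (1 - B)⁻¹ * (1 - B) = 1 :=
  nonsing_inv_mul _ ((isUnit_iff_isUnit_det _).1 (isUnit_one_sub_of_sum_lt_one hB hs))

theorem inv_one_sub_nonneg (hB : ∀ i j, 0 ≤ B i j) (hs : ∀ i, ∑ j, B i j < 1) (i j : Fin d) :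
    0 ≤ (1 - B)⁻¹ i j := by
  have h := nonneg_of_one_sub_mulVec_nonneg hB hs (x := (1 - B)⁻¹ *ᵥ Pi.single j 1) (by
    rw [mulVec_mulVec, one_sub_mul_inv hB hs, one_mulVec, Pi.single_nonneg]
    exact zero_le_one) i
  simpa using h

theorem one_le_inv_one_sub_mulVec_one (hB : ∀ i j, 0 ≤ B i j) (hs : ∀ i, ∑ j, B i j < 1) :
    1 ≤ (1 - B)⁻¹ *ᵥ (1 : Fin d → ℝ) := by
  refine sub_nonneg.1 (nonneg_of_one_sub_mulVec_nonneg hB hs ?_)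
  rw [mulVec_sub, mulVec_mulVec, one_sub_mul_inv hB hs, one_mulVec, sub_mulVec, one_mulVec,
    sub_sub_cancel]
  exact mulVec_nonneg_of_nonneg hB zero_le_one

end Substochastic

theorem matrix_mul_nonneg {d : ℕ} {A B : Matrix (Fin d) (Fin d) ℝ} (hA : ∀ i j, 0 ≤ A i j)
    (hB : ∀ i j, 0 ≤ B i j) (i j : Fin d) : 0 ≤ (A * B) i j := by
  rw [mul_apply]
  exact Finset.sum_nonneg fun k _ => mul_nonneg (hA i k) (hB k j)

theorem matrix_mul_mono {d : ℕ} {A A' B B' : Matrix (Fin d) (Fin d) ℝ} (hA : ∀ i j, 0 ≤ A i j)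
    (hB : ∀ i j, 0 ≤ B i j) (hAA : ∀ i j, A i j ≤ A' i j) (hBB : ∀ i j, B i j ≤ B' i j)
    (i j : Fin d) : (A * B) i j ≤ (A' * B') i j := by
  simp only [mul_apply]
  exact Finset.sum_le_sum fun k _ => mul_le_mul (hAA i k) (hBB k j) (hB k j)
    ((hA i k).trans (hAA i k))

theorem sum_row_eq_mulVec_one {d : ℕ} (B : Matrix (Fin d) (Fin d) ℝ) (i : Fin d) :
    ∑ j, B i j = (B *ᵥ 1) i := by
  simp [mulVec, dotProduct]

theorem sum_abs_lt_one_of_rowSumNorm_lt_one {d : ℕ} {B : Matrix (Fin d) (Fin d) ℝ}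
    (h : rowSumNorm B < 1) (i : Fin d) : ∑ j, |B i j| < 1 :=
  (le_ciSup (f := fun i => ∑ j, |B i j|) (Set.finite_range _).bddAbove i).trans_lt h

/-! ### The exit equation in polynomial form -/

namespace StripWalk

variable {d : ℕ} {W : StripWalk d} {ζ : Matrix (Fin d) (Fin d) ℝ}

theorem row_sum_apply (W : StripWalk d) (i : Fin d) :
    (W.P *ᵥ 1) i + (W.R *ᵥ 1) i + (W.Q *ᵥ 1) i = 1 := by
  have h := congrFun W.row_sum i
  simp only [add_mulVec, Pi.add_apply, Pi.one_apply] at h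
  linarith

theorem ConditionC.sum_RP_lt (hC : W.ConditionC) (i : Fin d) :
    (W.R *ᵥ 1) i + (W.P *ᵥ 1) i < 1 := by
  refine lt_of_le_of_lt ?_ (sum_abs_lt_one_of_rowSumNorm_lt_one hC.norm_RP i)
  rw [← Pi.add_apply, ← add_mulVec, ← sum_row_eq_mulVec_one]
  exact Finset.sum_le_sum fun j _ => le_abs_self _

theorem sum_RQ_le (W : StripWalk d) (i : Fin d) :
    (W.R *ᵥ 1) i + (W.Q *ᵥ 1) i ≤ rowSumNorm (W.R + W.Q) := by
  refine le_trans ?_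
    (le_ciSup (f := fun i => ∑ j, |(W.R + W.Q) i j|) (Set.finite_range _).bddAbove i)
  rw [← Pi.add_apply, ← add_mulVec, ← sum_row_eq_mulVec_one]
  exact Finset.sum_le_sum fun j _ => le_abs_self _

theorem mul_add_R_nonneg (W : StripWalk d) (hζ : ∀ i j, 0 ≤ ζ i j) (i j : Fin d) :
    0 ≤ (W.P * ζ + W.R) i j :=
  add_nonneg (matrix_mul_nonneg W.P_nonneg hζ i j) (W.R_nonneg i j)

theorem ConditionC.sum_mul_add_R_lt (hC : W.ConditionC) (hζ : ζ *ᵥ 1 = 1) (i : Fin d) :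
    ∑ j, (W.P * ζ + W.R) i j < 1 := by
  rw [sum_row_eq_mulVec_one, add_mulVec, ← mulVec_mulVec, hζ, Pi.add_apply, add_comm]
  exact hC.sum_RP_lt i

/-- For stochastic `ζ`, the rows of `Pζ + R` sum to those of `P + R`, hence to less than `1`. So `I
- Pζ - R` is invertible and can be cleared from the equation. -/
theorem isExitMatrix_iff (hC : W.ConditionC) : W.IsExitMatrix ζ ↔
    ζ ∈ rowStochastic ℝ (Fin d) ∧ ζ = W.P * (ζ * ζ) + W.R * ζ + W.Q := by
  refine and_congr_right fun hζ => ?_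
  have hn := W.mul_add_R_nonneg (ζ := ζ) fun i j => nonneg_of_mem_rowStochastic hζ
  have hs := hC.sum_mul_add_R_lt (ζ := ζ) (mem_rowStochastic.1 hζ).2
  have h : (1 - W.P * ζ - W.R) = 1 - (W.P * ζ + W.R) := sub_sub _ _ _
  have h2 : (1 - (W.P * ζ + W.R)) * ζ = ζ - (W.P * (ζ * ζ) + W.R * ζ) := by
    noncomm_ring
  rw [h]
  constructor
  · intro h1
    have h3 : (1 - (W.P * ζ + W.R)) * ζ = W.Q := by
      refine (congrArg (fun X => (1 - (W.P * ζ + W.R)) * X) h1).trans ?_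
      rw [← mul_assoc, one_sub_mul_inv hn hs, one_mul]
    rw [h2] at h3
    rw [← h3]
    abel
  · intro h1
    have h3 : (1 - (W.P * ζ + W.R)) * ζ = W.Q := by
      rw [h2, sub_eq_iff_eq_add, add_comm]
      exact h1
    rw [← h3, ← mul_assoc, inv_one_sub_mul hn hs, one_mul]

namespace IsExitMatrix

theorem nonneg (h : W.IsExitMatrix ζ) (i j : Fin d) : 0 ≤ ζ i j := nonneg_of_mem_rowStochastic h.1

theorem mulVec_one (h : W.IsExitMatrix ζ) : ζ *ᵥ 1 = 1 := (mem_rowStochastic.1 h.1).2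

theorem eq (h : W.IsExitMatrix ζ) (hC : W.ConditionC) : ζ = W.P * (ζ * ζ) + W.R * ζ + W.Q :=
  ((isExitMatrix_iff hC).1 h).2

theorem inv_nonneg (h : W.IsExitMatrix ζ) (hC : W.ConditionC) (i j : Fin d) :
    0 ≤ (1 - W.P * ζ - W.R)⁻¹ i j := by
  rw [sub_sub]
  exact inv_one_sub_nonneg (W.mul_add_R_nonneg h.nonneg) (hC.sum_mul_add_R_lt h.mulVec_one) i j

theorem mul_inv (h : W.IsExitMatrix ζ) (hC : W.ConditionC) :
    (1 - W.P * ζ - W.R) * (1 - W.P * ζ - W.R)⁻¹ = 1 := by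
  rw [sub_sub]
  exact one_sub_mul_inv (W.mul_add_R_nonneg h.nonneg) (hC.sum_mul_add_R_lt h.mulVec_one)

theorem inv_mul (h : W.IsExitMatrix ζ) (hC : W.ConditionC) :
    (1 - W.P * ζ - W.R)⁻¹ * (1 - W.P * ζ - W.R) = 1 := by
  rw [sub_sub]
  exact inv_one_sub_mul (W.mul_add_R_nonneg h.nonneg) (hC.sum_mul_add_R_lt h.mulVec_one)

theorem Aminus_nonneg (h : W.IsExitMatrix ζ) (hC : W.ConditionC) (i j : Fin d) :
    0 ≤ W.Aminus ζ i j :=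
  matrix_mul_nonneg (h.inv_nonneg hC) W.P_nonneg i j

theorem one_le_uminus (h : W.IsExitMatrix ζ) (hC : W.ConditionC) : 1 ≤ W.uminus ζ := by
  rw [uminus, sub_sub]
  exact one_le_inv_one_sub_mulVec_one (W.mul_add_R_nonneg h.nonneg)
    (hC.sum_mul_add_R_lt h.mulVec_one)

theorem Aminus_pow_nonneg (h : W.IsExitMatrix ζ) (hC : W.ConditionC) (k : ℕ) :
    ∀ i j, 0 ≤ (W.Aminus ζ ^ k) i j := by
  induction k with
  | zero =>
    intro i j
    rw [pow_zero, one_apply]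
    split_ifs <;> simp
  | succ k ih => rw [pow_succ]; exact matrix_mul_nonneg ih (h.Aminus_nonneg hC)

theorem Aminus_pow_mulVec_uminus_nonneg (h : W.IsExitMatrix ζ) (hC : W.ConditionC) (k : ℕ) :
    0 ≤ (W.Aminus ζ ^ k) *ᵥ W.uminus ζ :=
  mulVec_nonneg_of_nonneg (h.Aminus_pow_nonneg hC k) (zero_le_one.trans (h.one_le_uminus hC))

end IsExitMatrix

/-! ### Existence of an exit matrix -/

/-- The monotone iteration for the minimal nonnegative solution of `G = PG² + RG + Q`. -/
def exitIter (W : StripWalk d) : ℕ → Matrix (Fin d) (Fin d) ℝ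
  | 0 => 0
  | n + 1 => W.P * (exitIter W n * exitIter W n) + W.R * exitIter W n + W.Q

theorem exitIter_nonneg (W : StripWalk d) (n : ℕ) : ∀ i j, 0 ≤ W.exitIter n i j := by
  induction n with
  | zero => intro i j; simp [exitIter]
  | succ n ih =>
    exact fun i j => add_nonneg (add_nonneg (matrix_mul_nonneg W.P_nonneg
      (matrix_mul_nonneg ih ih) i j) (matrix_mul_nonneg W.R_nonneg ih i j)) (W.Q_nonneg i j)

theorem exitIter_le_succ (W : StripWalk d) (n : ℕ) :
    ∀ i j, W.exitIter n i j ≤ W.exitIter (n + 1) i j := by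
  induction n with
  | zero => intro i j; simpa [exitIter] using W.Q_nonneg i j
  | succ n ih =>
    have h0 := W.exitIter_nonneg n
    exact fun i j => add_le_add (add_le_add
      (matrix_mul_mono W.P_nonneg (matrix_mul_nonneg h0 h0) (fun _ _ => le_rfl)
        (matrix_mul_mono h0 h0 ih ih) i j)
      (matrix_mul_mono W.R_nonneg h0 (fun _ _ => le_rfl) ih i j)) le_rfl

theorem exitIter_mulVec_one_le (W : StripWalk d) (n : ℕ) : W.exitIter n *ᵥ 1 ≤ 1 := by
  induction n with
  | zero => simp [exitIter]
  | succ n ih =>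
    have h1 := mulVec_mono_of_nonneg (W.exitIter_nonneg n) ih
    have h2 := mulVec_mono_of_nonneg W.P_nonneg (h1.trans ih)
    have h3 := mulVec_mono_of_nonneg W.R_nonneg ih
    intro i
    rw [exitIter, add_mulVec, add_mulVec, ← mulVec_mulVec, ← mulVec_mulVec, ← mulVec_mulVec]
    have h4 := W.row_sum_apply i
    have h2i := h2 i
    have h3i := h3 i
    simp only [Pi.add_apply, Pi.one_apply]
    linarith

theorem exists_substochastic_solution (W : StripWalk d) : ∃ G : Matrix (Fin d) (Fin d) ℝ,
    (∀ i j, 0 ≤ G i j) ∧ G *ᵥ 1 ≤ 1 ∧ G = W.P * (G * G) + W.R * G + W.Q := by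
  have hle : ∀ n i j, W.exitIter n i j ≤ 1 := fun n i j =>
    (Finset.single_le_sum (fun k _ => W.exitIter_nonneg n i k) (Finset.mem_univ j)).trans
      ((sum_row_eq_mulVec_one _ i).trans_le (W.exitIter_mulVec_one_le n i))
  have hlim : Filter.Tendsto W.exitIter Filter.atTop
      (nhds (Matrix.of fun i j => ⨆ n, W.exitIter n i j)) := by
    refine tendsto_pi_nhds.2 fun i => tendsto_pi_nhds.2 fun j => ?_
    exact tendsto_atTop_ciSup (monotone_nat_of_le_succ fun n => W.exitIter_le_succ n i j)
      ⟨1, by rintro _ ⟨n, rfl⟩; exact hle n i j⟩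
  set G : Matrix (Fin d) (Fin d) ℝ := Matrix.of fun i j => ⨆ n, W.exitIter n i j
  refine ⟨G, fun i j => ?_, ?_, ?_⟩
  · exact ge_of_tendsto' (tendsto_pi_nhds.1 (tendsto_pi_nhds.1 hlim i) j)
      fun n => W.exitIter_nonneg n i j
  · exact le_of_tendsto' (tendsto_mulVec hlim tendsto_const_nhds) W.exitIter_mulVec_one_le
  · have hc : Continuous fun G : Matrix (Fin d) (Fin d) ℝ => W.P * (G * G) + W.R * G + W.Q := by
      fun_prop
    exact tendsto_nhds_unique (hlim.comp (Filter.tendsto_add_atTop_nat 1))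
      ((hc.tendsto G).comp hlim)

/-- The substochastic solution `G` may lose mass `h = 1 - G1`. The loss is redistributed along a
left Perron vector `w` of `G`, giving `G + h w'`. -/
theorem exists_isExitMatrix (hd : 0 < d) (hC : W.ConditionC) : ∃ ζ, W.IsExitMatrix ζ := by
  obtain ⟨G, hG0, hG1, hG⟩ := W.exists_substochastic_solution
  obtain ⟨η, -, w, hw, hwη, -⟩ := exists_perron hd (A := Gᵀ) fun i j => hG0 j i
  rw [mulVec_transpose] at hwη
  have hw1 : w ⬝ᵥ 1 = 1 := by simpa [dotProduct] using hw.2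
  set h : Fin d → ℝ := 1 - G *ᵥ 1 with hh
  have hwh : w ⬝ᵥ h = 1 - η := by
    rw [hh, dotProduct_sub, dotProduct_mulVec, hwη, smul_dotProduct, hw1, smul_eq_mul, mul_one]
  -- The cross term contributes `η h w'` and the square of the rank-one term `(1 - η) h w'`, so `η`
  -- cancels.
  have hGG : (G + vecMulVec h w) * (G + vecMulVec h w) = G * G + vecMulVec (G *ᵥ h + h) w := by
    rw [add_mul, mul_add, mul_add, mul_vecMulVec, vecMulVec_mul, hwη, vecMulVec_mul_vecMulVec, hwh]
    ext i j
    simp only [Matrix.add_apply, vecMulVec_apply, Pi.add_apply, Pi.smul_apply, smul_eq_mul]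
    ring
  -- Since `Gh + h = 1 - G²1`, this is the row-sum identity minus the equation for `G` applied to
  -- `1`.
  have hfix : W.P *ᵥ (G *ᵥ h + h) + W.R *ᵥ h = h := by
    have h1 : G *ᵥ 1 = W.P *ᵥ (G *ᵥ (G *ᵥ 1)) + W.R *ᵥ (G *ᵥ 1) + W.Q *ᵥ 1 := by
      conv_lhs => rw [hG]
      simp only [add_mulVec, mulVec_mulVec]
    ext i
    have h1i := congrFun h1 i
    have h2 := W.row_sum_apply i
    simp only [hh, mulVec_sub, mulVec_add, Pi.add_apply, Pi.sub_apply, Pi.one_apply] at h1i h2 ⊢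
    linarith
  refine ⟨G + vecMulVec h w, (isExitMatrix_iff hC).2 ⟨mem_rowStochastic.2 ⟨fun i j => ?_, ?_⟩, ?_⟩⟩
  · exact add_nonneg (hG0 i j) (mul_nonneg (sub_nonneg.2 (hG1 i)) (hw.1 j))
  · ext i
    have : (vecMulVec h w *ᵥ 1) i = h i := by
      simp only [mulVec, dotProduct, vecMulVec_apply, Pi.one_apply, mul_one, ← Finset.mul_sum]
      rw [hw.2, mul_one]
    rw [add_mulVec, Pi.add_apply, this, hh]
    simp
  · rw [hGG, mul_add, mul_add, mul_vecMulVec, mul_vecMulVec]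
    nth_rw 1 [hG]
    nth_rw 1 [← hfix]
    rw [add_vecMulVec]
    abel

/-! ### Consequences of finite `rhoBar` -/

/-- Each column `j` of `P` has a positive entry, so the `j`-th series enters `rhoBar` with positive
weight. -/
theorem ConditionC.rhoBar_lt_top_iff (hC : W.ConditionC) :
    W.rhoBar ζ < ∞ ↔
      ∀ j, ∑' k : ℕ, ENNReal.ofReal (((W.Aminus ζ ^ k) *ᵥ W.uminus ζ) j) < ∞ := by
  constructor
  · intro h j
    have hj : ∃ i, 0 < W.P i j := by
      by_contra! hn
      exact (hC.col_P j).not_ge (Finset.sum_nonpos fun i _ => hn i)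
    obtain ⟨i, hi⟩ := hj
    have h1 := (ENNReal.add_lt_top.1 h).1
    have h2 := ENNReal.sum_lt_top.1 (ENNReal.sum_lt_top.1 h1 i (Finset.mem_univ i)) j
      (Finset.mem_univ j)
    exact ENNReal.lt_top_of_mul_ne_top_right h2.ne (ENNReal.ofReal_pos.2 hi).ne'
  · exact fun h => ENNReal.add_lt_top.2 ⟨ENNReal.sum_lt_top.2 fun i _ => ENNReal.sum_lt_top.2
      fun j _ => ENNReal.mul_lt_top ENNReal.ofReal_lt_top (h j), ENNReal.natCast_lt_top d⟩

theorem IsExitMatrix.summable_of_rhoBar_lt_top (h : W.IsExitMatrix ζ) (hC : W.ConditionC)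
    (hρ : W.rhoBar ζ < ∞) : Summable fun k : ℕ => (W.Aminus ζ ^ k) *ᵥ W.uminus ζ := by
  refine Pi.summable.2 fun j => ?_
  have h1 := ENNReal.summable_toReal (hC.rhoBar_lt_top_iff.1 hρ j).ne
  refine h1.congr fun k => ?_
  exact ENNReal.toReal_ofReal (h.Aminus_pow_mulVec_uminus_nonneg hC k j)

theorem pow_mulVec_of_eigenvector {A : Matrix (Fin d) (Fin d) ℝ} {r : ℝ} {x : Fin d → ℝ}
    (h : A *ᵥ x = r • x) (k : ℕ) : (A ^ k) *ᵥ x = r ^ k • x := by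
  induction k with
  | zero => simp
  | succ k ih => rw [pow_succ, ← mulVec_mulVec, h, mulVec_smul, ih, smul_smul, pow_succ']

/-- From `x ≤ 1 ≤ u⁻` follows `r^k x ≤ (A⁻)^k u⁻`, which tends to `0`; at a positive entry of `x`
this excludes `r ≥ 1`. -/
theorem IsExitMatrix.eigenvalue_lt_one (h : W.IsExitMatrix ζ) (hC : W.ConditionC)
    (hρ : W.rhoBar ζ < ∞) {r : ℝ} {x : Fin d → ℝ} (hx : x ∈ stdSimplex ℝ (Fin d))
    (hr : W.Aminus ζ *ᵥ x = r • x) : r < 1 := by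
  obtain ⟨j, hj⟩ := Function.ne_iff.1 (ne_zero_of_mem_stdSimplex hx)
  have hj : 0 < x j := lt_of_le_of_ne (hx.1 j) (Ne.symm hj)
  have hxu : x ≤ W.uminus ζ := fun i =>
    (hx.2 ▸ Finset.single_le_sum (fun k _ => hx.1 k) (Finset.mem_univ i) : x i ≤ 1).trans
      (h.one_le_uminus hC i)
  have hlim := (Pi.summable.1 (h.summable_of_rhoBar_lt_top hC hρ) j).tendsto_atTop_zero
  by_contra! h1
  refine hj.not_ge (ge_of_tendsto' hlim fun k => ?_)
  calc x j ≤ r ^ k * x j := le_mul_of_one_le_left hj.le (one_le_pow₀ h1)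
    _ = ((W.Aminus ζ ^ k) *ᵥ x) j := by rw [pow_mulVec_of_eigenvector hr]; rfl
    _ ≤ _ := mulVec_mono_of_nonneg (h.Aminus_pow_nonneg hC k) hxu j

/-- If `rhoBar` is finite, then the sum of the `A⁻ ^ k u⁻` is the vector of the mean times of
descent by one layer. -/
theorem IsExitMatrix.exists_descent_time (h : W.IsExitMatrix ζ) (hC : W.ConditionC)
    (hρ : W.rhoBar ζ < ∞) : ∃ v : Fin d → ℝ, 0 ≤ v ∧
      v = 1 + W.P *ᵥ (v + ζ *ᵥ v) + W.R *ᵥ v := by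
  have hs := h.summable_of_rhoBar_lt_top hC hρ
  set v := ∑' k : ℕ, (W.Aminus ζ ^ k) *ᵥ W.uminus ζ
  have hAv : HasSum (fun k : ℕ => W.Aminus ζ *ᵥ ((W.Aminus ζ ^ k) *ᵥ W.uminus ζ))
      (W.Aminus ζ *ᵥ v) :=
    hs.hasSum.map (W.Aminus ζ).mulVecLin (Continuous.matrix_mulVec continuous_const continuous_id)
  have hv : v = W.uminus ζ + W.Aminus ζ *ᵥ v := by
    refine hs.tsum_eq_zero_add.trans ?_
    rw [← hAv.tsum_eq]
    simp [pow_succ']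
  refine ⟨v, tsum_nonneg fun k => h.Aminus_pow_mulVec_uminus_nonneg hC k, ?_⟩
  have h1 : (1 - W.P * ζ - W.R) *ᵥ v = 1 + W.P *ᵥ v := by
    conv_lhs => rw [hv, uminus, Aminus, ← mulVec_mulVec, ← mulVec_add, mulVec_mulVec,
      h.mul_inv hC, one_mulVec]
  rw [sub_mulVec, sub_mulVec, one_mulVec, ← mulVec_mulVec, sub_sub, sub_eq_iff_eq_add] at h1
  rw [mulVec_add]
  conv_lhs => rw [h1]
  abel

/-! ### Sufficiency: a supersolution vanishing on layer `y` -/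

/-- Mean time of descent by `n` layers, given the vector `v` of the mean times for one layer. -/
def descentTime (ζ : Matrix (Fin d) (Fin d) ℝ) (v : Fin d → ℝ) : ℕ → Fin d → ℝ
  | 0 => 0
  | n + 1 => v + ζ *ᵥ descentTime ζ v n

theorem descentTime_nonneg (hζ : ∀ i j, 0 ≤ ζ i j) {v : Fin d → ℝ} (hv : 0 ≤ v) (n : ℕ) :
    0 ≤ descentTime ζ v n := by
  induction n with
  | zero => exact le_rfl
  | succ n ih => exact add_nonneg hv (mulVec_nonneg_of_nonneg hζ ih)

/-- The equation of `v` accounts for the first layer of descent; that of `ζ`, applied to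
`descentTime ζ v n`, accounts for the rest. -/
theorem descentTime_succ_eq (hζ : ζ = W.P * (ζ * ζ) + W.R * ζ + W.Q) {v : Fin d → ℝ}
    (hv : v = 1 + W.P *ᵥ (v + ζ *ᵥ v) + W.R *ᵥ v) (n : ℕ) :
    descentTime ζ v (n + 1) = 1 + W.P *ᵥ descentTime ζ v (n + 2) +
      W.R *ᵥ descentTime ζ v (n + 1) + W.Q *ᵥ descentTime ζ v n := by
  have h1 : ∀ w : Fin d → ℝ,
      ζ *ᵥ w = W.P *ᵥ (ζ *ᵥ (ζ *ᵥ w)) + W.R *ᵥ (ζ *ᵥ w) + W.Q *ᵥ w := fun w => by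
    conv_lhs => rw [hζ]
    simp only [add_mulVec, mulVec_mulVec]
  ext i
  have h1i := congrFun (h1 (descentTime ζ v n)) i
  have hvi := congrFun hv i
  simp only [descentTime, mulVec_add, Pi.add_apply] at hvi h1i ⊢
  linarith

/-- A function vanishing on layer `y` does not see the killing there. -/
theorem killed_ofReal_zero {y : ℕ} {g : ℕ → Fin d → ℝ} (h0 : ∀ n, 0 ≤ g n) (hy : g y = 0)
    (i : Fin d) : W.killed y (fun x => ENNReal.ofReal (g x.1 x.2)) (0, i) =
      ENNReal.ofReal ((W.P₀ *ᵥ g 1) i) := by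
  have hP : ∀ j, 0 ≤ W.P₀ i j := fun j => nonneg_of_mem_rowStochastic W.P₀_stochastic
  rw [killed_zero]
  simp only [mulVec, dotProduct]
  rw [ENNReal.ofReal_sum_of_nonneg fun j _ => mul_nonneg (hP j) (h0 1 j)]
  refine Finset.sum_congr rfl fun j _ => ?_
  rw [ENNReal.ofReal_mul (hP j)]
  split_ifs with h
  · rw [h, hy]; simp
  · rfl

theorem killed_ofReal_succ {y : ℕ} {g : ℕ → Fin d → ℝ} (h0 : ∀ n, 0 ≤ g n) (hy : g y = 0)
    (n : ℕ) (i : Fin d) : W.killed y (fun x => ENNReal.ofReal (g x.1 x.2)) (n + 1, i) =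
      ENNReal.ofReal ((W.P *ᵥ g (n + 2) + W.R *ᵥ g (n + 1) + W.Q *ᵥ g n) i) := by
  have hite : ∀ m j, (if m = y then 0 else ENNReal.ofReal (g m j)) = ENNReal.ofReal (g m j) := by
    intro m j
    split_ifs with h
    · rw [h, hy]; simp
    · rfl
  have hP := fun j => mul_nonneg (W.P_nonneg i j) (h0 (n + 2) j)
  have hR := fun j => mul_nonneg (W.R_nonneg i j) (h0 (n + 1) j)
  have hQ := fun j => mul_nonneg (W.Q_nonneg i j) (h0 n j)
  rw [killed_succ]
  simp only [hite, Pi.add_apply, mulVec, dotProduct, ← Finset.sum_add_distrib]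
  rw [ENNReal.ofReal_sum_of_nonneg fun j _ => add_nonneg (add_nonneg (hP j) (hR j)) (hQ j)]
  refine Finset.sum_congr rfl fun j _ => ?_
  rw [ENNReal.ofReal_add (add_nonneg (hP j) (hR j)) (hQ j), ENNReal.ofReal_add (hP j) (hR j),
    ENNReal.ofReal_mul (W.P_nonneg i j), ENNReal.ofReal_mul (W.R_nonneg i j),
    ENNReal.ofReal_mul (W.Q_nonneg i j)]

theorem layerPositiveRecurrent_of_real_supersolution {y : ℕ} {g : ℕ → Fin d → ℝ}
    (h0 : ∀ n, 0 ≤ g n) (hy : g y = 0) (hzero : y ≠ 0 → 1 + W.P₀ *ᵥ g 1 ≤ g 0)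
    (hsucc : ∀ n, n + 1 ≠ y →
      1 + (W.P *ᵥ g (n + 2) + W.R *ᵥ g (n + 1) + W.Q *ᵥ g n) ≤ g (n + 1)) :
    W.LayerPositiveRecurrent y := by
  -- The inequality for `g` fails on layer `y`, where `g = 0`. One application of `1 + killed` lies
  -- below `g` off that layer and is a supersolution everywhere.
  refine W.layerPositiveRecurrent_of_supersolution y
    (f := fun x => 1 + W.killed y (fun x => ENNReal.ofReal (g x.1 x.2)) x) (fun x => ?_)
    fun i => ?_
  · refine add_le_add_right (W.killed_mono y (fun x hx => ?_) x) 1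
    obtain ⟨n, i⟩ := x
    have h1 : (1 : ℝ≥0∞) = ENNReal.ofReal 1 := ENNReal.ofReal_one.symm
    cases n with
    | zero =>
      rw [killed_ofReal_zero h0 hy, h1, ← ENNReal.ofReal_add zero_le_one]
      · exact ENNReal.ofReal_le_ofReal (hzero (Ne.symm hx) i)
      · exact mulVec_nonneg_of_nonneg (fun i j => nonneg_of_mem_rowStochastic W.P₀_stochastic)
          (h0 1) i
    | succ n =>
      rw [killed_ofReal_succ h0 hy, h1, ← ENNReal.ofReal_add zero_le_one]
      · exact ENNReal.ofReal_le_ofReal (hsucc n hx i)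
      · exact add_nonneg (add_nonneg (mulVec_nonneg_of_nonneg W.P_nonneg (h0 _) i)
          (mulVec_nonneg_of_nonneg W.R_nonneg (h0 _) i))
          (mulVec_nonneg_of_nonneg W.Q_nonneg (h0 _) i)
  · refine ENNReal.add_lt_top.2 ⟨ENNReal.one_lt_top, ?_⟩
    cases y with
    | zero => rw [killed_ofReal_zero h0 hy]; exact ENNReal.ofReal_lt_top
    | succ n => rw [killed_ofReal_succ h0 hy]; exact ENNReal.ofReal_lt_top

theorem mulVec_const_apply (B : Matrix (Fin d) (Fin d) ℝ) (c : ℝ) (i : Fin d) :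
    (B *ᵥ fun _ => c) i = (B *ᵥ 1) i * c := by
  simp [mulVec, dotProduct, Finset.sum_mul]

/-- A bound on the mean time of ascent from layer `m` to layer `y`. -/
def ascentBound (K : ℝ) (y m : ℕ) : ℝ := ∑ k ∈ Finset.Ioc m y, K ^ k

theorem ascentBound_of_le {K : ℝ} {y m : ℕ} (h : y ≤ m) : ascentBound K y m = 0 := by
  rw [ascentBound, Finset.Ioc_eq_empty (by omega), Finset.sum_empty]

theorem ascentBound_of_lt {K : ℝ} {y m : ℕ} (h : m < y) :
    ascentBound K y m = ascentBound K y (m + 1) + K ^ (m + 1) := by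
  rw [ascentBound, ascentBound, ← Finset.Icc_add_one_left_eq_Ioc, ← Finset.Ioc_insert_left h,
    Finset.sum_insert (by simp), add_comm]

theorem IsExitMatrix.layerPositiveRecurrent (h : W.IsExitMatrix ζ) (hC : W.ConditionC)
    (hρ : W.rhoBar ζ < ∞) (y : ℕ) : W.LayerPositiveRecurrent y := by
  obtain ⟨v, hv0, hv⟩ := h.exists_descent_time hC hρ
  have hdesc := descentTime_succ_eq (h.eq hC) hv
  -- `ε` bounds the upward probability from below; `K` makes each upward gain outweigh the downward
  -- loss by a factor of two.
  set ε := 1 - rowSumNorm (W.R + W.Q) with hε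
  have hε0 : 0 < ε := sub_pos.2 hC.norm_RQ
  have hPε : ∀ i, ε ≤ (W.P *ᵥ 1) i := fun i => by
    have h1 := W.sum_RQ_le i
    have h2 := W.row_sum_apply i
    linarith
  set K := max 1 (2 / ε) with hK
  have hK1 : 1 ≤ K := le_max_left _ _
  have hKε : 2 ≤ ε * K := by
    have : 2 / ε ≤ K := le_max_right _ _
    rwa [div_le_iff₀' hε0] at this
  have hV0 : ∀ m, 0 ≤ ascentBound K y m := fun m =>
    Finset.sum_nonneg fun k _ => pow_nonneg (zero_le_one.trans hK1) k
  refine layerPositiveRecurrent_of_real_supersolution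
    -- Both summands vanish at `m = y`; truncated subtraction kills the descent part below `y`, and
    -- the empty sum kills the ascent part above.
    (g := fun m => (fun _ => ascentBound K y m) + descentTime ζ v (m - y))
    (fun n => add_nonneg (fun _ => hV0 n) (descentTime_nonneg h.nonneg hv0 _)) ?_ ?_ ?_
  · rw [ascentBound_of_le le_rfl, Nat.sub_self]
    simp [descentTime, Pi.zero_def]
  · intro hy i
    have e1 : 1 - y = 0 := by omega
    have e2 : 0 - y = 0 := by omega
    have h1 := ascentBound_of_lt (K := K) (Nat.pos_of_ne_zero hy)
    have h2 : (W.P₀ *ᵥ 1) i = 1 := congrFun (mem_rowStochastic.1 W.P₀_stochastic).2 i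
    simp only [e1, e2, descentTime, add_zero, Pi.add_apply, Pi.zero_apply, Pi.one_apply,
      mulVec_const_apply, h2]
    simp only [zero_add, pow_one] at h1
    linarith
  · intro n hn
    rcases lt_or_ge n y with hlt | hge
    · intro i
      have e1 : n + 2 - y = 0 := by omega
      have e2 : n + 1 - y = 0 := by omega
      have e3 : n - y = 0 := by omega
      have h1 := ascentBound_of_lt (K := K) hlt
      have h2 := ascentBound_of_lt (K := K) (show n + 1 < y by omega)
      have h3 := W.row_sum_apply i
      have hp := hPε i
      have hr : 0 ≤ (W.R *ᵥ 1) i := mulVec_nonneg_of_nonneg W.R_nonneg zero_le_one i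
      have hKn : 1 ≤ K ^ (n + 1) := one_le_pow₀ hK1
      simp only [e1, e2, e3, descentTime, add_zero, Pi.add_apply, Pi.zero_apply, Pi.one_apply,
        mulVec_const_apply]
      set p := (W.P *ᵥ 1) i
      set r := (W.R *ᵥ 1) i
      set q := (W.Q *ᵥ 1) i
      -- The drift toward `y` is `p K^(n+2) - q K^(n+1) ≥ K^(n+1) ≥ 1`.
      have hq : q ≤ 1 := by linarith
      have h4 : 2 * K ^ (n + 1) ≤ p * K ^ (n + 1 + 1) := by
        rw [pow_succ K (n + 1)]
        have : 2 ≤ p * K := hKε.trans (mul_le_mul_of_nonneg_right hp (zero_le_one.trans hK1))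
        nlinarith
      have h5 : q * K ^ (n + 1) ≤ K ^ (n + 1) :=
        mul_le_of_le_one_left (zero_le_one.trans hKn) hq
      have h6 : r = 1 - p - q := by linarith
      rw [h1, h2, h6]
      rw [show n + 1 + 1 = n + 2 from rfl] at h4 ⊢
      nlinarith
    · obtain ⟨k, rfl⟩ := Nat.exists_eq_add_of_le hge
      have e1 : y + k + 2 - y = k + 2 := by omega
      have e2 : y + k + 1 - y = k + 1 := by omega
      have e3 : y + k - y = k := by omega
      have e4 : ((fun _ => 0 : Fin d → ℝ)) = 0 := rfl
      simp only [e1, e2, e3, ascentBound_of_le (show y ≤ y + k + 2 by omega),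
        ascentBound_of_le (show y ≤ y + k + 1 by omega),
        ascentBound_of_le (show y ≤ y + k by omega), e4, zero_add]
      exact ((hdesc k).trans (by abel)).ge

/-! ### Necessity: truncated descent times and first passages -/

/-- The mean of the minimum of `T` and the time of descent by `n` layers. -/
def truncatedDescent (W : StripWalk d) : ℕ → ℕ → Fin d → ℝ
  | 0, _ => 0
  | _ + 1, 0 => 0
  | T + 1, n + 1 => 1 + W.P *ᵥ truncatedDescent W T (n + 2) +
      W.R *ᵥ truncatedDescent W T (n + 1) + W.Q *ᵥ truncatedDescent W T n

/-- The probabilities of a descent by `n` layers within time `T`, by initial and final phase. -/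
def firstPassage (W : StripWalk d) : ℕ → ℕ → Matrix (Fin d) (Fin d) ℝ
  | 0, 0 => 1
  | 0, _ + 1 => 0
  | _ + 1, 0 => 1
  | T + 1, n + 1 => W.P * firstPassage W T (n + 2) + W.R * firstPassage W T (n + 1) +
      W.Q * firstPassage W T n

theorem truncatedDescent_succ_succ (W : StripWalk d) (T n : ℕ) :
    W.truncatedDescent (T + 1) (n + 1) = 1 + W.P *ᵥ W.truncatedDescent T (n + 2) +
      W.R *ᵥ W.truncatedDescent T (n + 1) + W.Q *ᵥ W.truncatedDescent T n := rfl

theorem truncatedDescent_layer_zero (W : StripWalk d) (T : ℕ) : W.truncatedDescent T 0 = 0 := by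
  cases T <;> rfl

theorem firstPassage_layer_zero (W : StripWalk d) (T : ℕ) : W.firstPassage T 0 = 1 := by
  cases T <;> rfl

theorem truncatedDescent_nonneg (W : StripWalk d) (T n : ℕ) : 0 ≤ W.truncatedDescent T n := by
  induction T generalizing n with
  | zero => exact le_rfl
  | succ T ih =>
    cases n with
    | zero => exact le_rfl
    | succ n =>
      exact add_nonneg (add_nonneg (add_nonneg zero_le_one
        (mulVec_nonneg_of_nonneg W.P_nonneg (ih _))) (mulVec_nonneg_of_nonneg W.R_nonneg (ih _)))
        (mulVec_nonneg_of_nonneg W.Q_nonneg (ih _))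

theorem truncatedDescent_le_succ (W : StripWalk d) (T n : ℕ) :
    W.truncatedDescent T n ≤ W.truncatedDescent (T + 1) n := by
  induction T generalizing n with
  | zero => exact W.truncatedDescent_nonneg 1 n
  | succ T ih =>
    cases n with
    | zero => exact le_rfl
    | succ n =>
      exact add_le_add (add_le_add (add_le_add le_rfl
        (mulVec_mono_of_nonneg W.P_nonneg (ih _))) (mulVec_mono_of_nonneg W.R_nonneg (ih _)))
        (mulVec_mono_of_nonneg W.Q_nonneg (ih _))

theorem truncatedDescent_mono (W : StripWalk d) (n : ℕ) :
    Monotone fun T => W.truncatedDescent T n :=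
  monotone_nat_of_le_succ fun T => W.truncatedDescent_le_succ T n

theorem firstPassage_nonneg (W : StripWalk d) (T n : ℕ) :
    ∀ i j, 0 ≤ W.firstPassage T n i j := by
  have h1 : ∀ i j, 0 ≤ (1 : Matrix (Fin d) (Fin d) ℝ) i j := fun i j => by
    rw [one_apply]; split_ifs <;> simp
  induction T generalizing n with
  | zero =>
    cases n with
    | zero => exact h1
    | succ n => exact fun i j => le_rfl
  | succ T ih =>
    cases n with
    | zero => exact h1
    | succ n =>
      exact fun i j => add_nonneg (add_nonneg (matrix_mul_nonneg W.P_nonneg (ih _) i j)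
        (matrix_mul_nonneg W.R_nonneg (ih _) i j)) (matrix_mul_nonneg W.Q_nonneg (ih _) i j)

/-- The powers of `ζ` solve the same recursion in `n`, with larger data at `T = 0`. -/
theorem firstPassage_le_pow (hζ0 : ∀ i j, 0 ≤ ζ i j)
    (hζ : ζ = W.P * (ζ * ζ) + W.R * ζ + W.Q) (T n : ℕ) :
    ∀ i j, W.firstPassage T n i j ≤ (ζ ^ n) i j := by
  have hpow : ∀ n, ∀ i j, 0 ≤ (ζ ^ n) i j := by
    intro n
    induction n with
    | zero => intro i j; rw [pow_zero, one_apply]; split_ifs <;> simp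
    | succ n ih => rw [pow_succ]; exact matrix_mul_nonneg ih hζ0
  induction T generalizing n with
  | zero =>
    cases n with
    | zero => exact fun i j => (congrFun (congrFun (pow_zero ζ).symm i) j).le
    | succ n => exact hpow _
  | succ T ih =>
    cases n with
    | zero => exact fun i j => (congrFun (congrFun (pow_zero ζ).symm i) j).le
    | succ n =>
      have h1 : ζ ^ (n + 1) = W.P * ζ ^ (n + 2) + W.R * ζ ^ (n + 1) + W.Q * ζ ^ n := by
        rw [pow_succ' ζ (n + 1), pow_succ' ζ n]
        conv_lhs => enter [1]; rw [hζ]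
        simp only [add_mul, mul_assoc]
      rw [h1]
      exact fun i j => add_le_add (add_le_add
        (matrix_mul_mono W.P_nonneg (W.firstPassage_nonneg T _) (fun _ _ => le_rfl) (ih _) i j)
        (matrix_mul_mono W.R_nonneg (W.firstPassage_nonneg T _) (fun _ _ => le_rfl) (ih _) i j))
        (matrix_mul_mono W.Q_nonneg (W.firstPassage_nonneg T _) (fun _ _ => le_rfl) (ih _) i j)

/-- Raising the truncation from `T` to `T + 1` adds the probability that the descent takes longer
than `T`. -/
theorem firstPassage_mulVec_one (W : StripWalk d) (T n : ℕ) :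
    W.firstPassage T n *ᵥ 1 = 1 - (W.truncatedDescent (T + 1) n - W.truncatedDescent T n) := by
  induction T generalizing n with
  | zero => cases n <;> simp [firstPassage, truncatedDescent]
  | succ T ih =>
    cases n with
    | zero => simp [firstPassage, truncatedDescent]
    | succ n =>
      rw [firstPassage, add_mulVec, add_mulVec, ← mulVec_mulVec, ← mulVec_mulVec, ← mulVec_mulVec,
        ih, ih, ih]
      ext i
      have h1 := congrFun (W.truncatedDescent_succ_succ (T + 1) n) i
      have h2 := congrFun (W.truncatedDescent_succ_succ T n) i
      have h := W.row_sum_apply i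
      simp only [mulVec_sub, Pi.add_apply, Pi.sub_apply, Pi.one_apply] at h1 h2 ⊢
      linarith

/-- The strong Markov property at the first passage to layer `1`. -/
theorem truncatedDescent_add_le (W : StripWalk d) (S T n : ℕ) :
    W.truncatedDescent T n + W.firstPassage T n *ᵥ W.truncatedDescent S 1 ≤
      W.truncatedDescent (T + S) (n + 1) := by
  induction T generalizing n with
  | zero =>
    cases n with
    | zero => simp [firstPassage, truncatedDescent]
    | succ n => simpa [firstPassage, truncatedDescent] using W.truncatedDescent_nonneg S (n + 2)
  | succ T ih =>
    cases n with
    | zero =>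
      rw [truncatedDescent_layer_zero, firstPassage_layer_zero, one_mulVec, zero_add, zero_add]
      exact W.truncatedDescent_mono 1 (by omega)
    | succ n =>
      have hP := mulVec_mono_of_nonneg W.P_nonneg (ih (n + 2))
      have hR := mulVec_mono_of_nonneg W.R_nonneg (ih (n + 1))
      have hQ := mulVec_mono_of_nonneg W.Q_nonneg (ih n)
      rw [show T + 1 + S = (T + S) + 1 by omega, firstPassage,
        truncatedDescent_succ_succ, truncatedDescent_succ_succ]
      intro i
      have hPi := hP i
      have hRi := hR i
      have hQi := hQ i
      simp only [mulVec_add, add_mulVec, mulVec_mulVec, Pi.add_apply] at hPi hRi hQi ⊢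
      linarith

/-- Before reaching layer `y` from above, the walk uses only `P`, `Q`, `R`. At `n = 0` the left side
is `0`, while the right side counts steps of the excursion. -/
theorem ofReal_truncatedDescent_le (W : StripWalk d) (y T n : ℕ) (i : Fin d) :
    ENNReal.ofReal (W.truncatedDescent T n i) ≤ W.meanAvoid y T (y + n, i) := by
  induction T generalizing n i with
  | zero => simp [truncatedDescent]
  | succ T ih =>
    cases n with
    | zero => simp [truncatedDescent]
    | succ n =>
      have h0 := W.truncatedDescent_nonneg T
      -- Layer `0` here stands for the target of the descent, that is, layer `y` after translation.
      have hk := W.killed_ofReal_succ (y := 0) h0 (W.truncatedDescent_layer_zero T) n i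
      have hnn : 0 ≤ (W.P *ᵥ W.truncatedDescent T (n + 2) + W.R *ᵥ W.truncatedDescent T (n + 1) +
          W.Q *ᵥ W.truncatedDescent T n) i :=
        add_nonneg (add_nonneg (mulVec_nonneg_of_nonneg W.P_nonneg (h0 _) i)
          (mulVec_nonneg_of_nonneg W.R_nonneg (h0 _) i))
          (mulVec_nonneg_of_nonneg W.Q_nonneg (h0 _) i)
      rw [truncatedDescent, add_assoc, add_assoc, ← add_assoc (W.P *ᵥ _), Pi.add_apply,
        Pi.one_apply, ENNReal.ofReal_add zero_le_one hnn, ENNReal.ofReal_one, ← hk,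
        meanAvoid_succ, ← add_assoc y n 1, killed_succ, killed_succ]
      refine add_le_add_right (Finset.sum_le_sum fun j _ => ?_) 1
      refine add_le_add (add_le_add ?_ ?_) ?_ <;> refine mul_le_mul_right ?_ _
      · simpa [add_assoc] using ih (n + 2) j
      · simpa [add_assoc] using ih (n + 1) j
      · rcases Nat.eq_zero_or_pos n with rfl | hn
        · simp
        · simpa [hn.ne'] using ih n j

/-- A nonzero column `j` of `P₀` or `P` supplies a phase of layer `y` that jumps to `(y + 1, j)`
with probability `c > 0`. -/
theorem ConditionC.exists_ascent (hC : W.ConditionC) (y : ℕ) (j : Fin d) :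
    ∃ (i : Fin d) (c : ℝ), 0 < c ∧ ∀ T,
      ENNReal.ofReal c * W.meanAvoid y T (y + 1, j) ≤ W.meanAvoid y (T + 1) (y, i) := by
  have hpos : ∀ {B : Matrix (Fin d) (Fin d) ℝ}, 0 < ∑ i, B i j → ∃ i, 0 < B i j := by
    intro B hB
    by_contra! hn
    exact hB.not_ge (Finset.sum_nonpos fun i _ => hn i)
  cases y with
  | zero =>
    obtain ⟨i, hi⟩ := hpos (hC.col_P₀ j)
    refine ⟨i, W.P₀ i j, hi, fun T => ?_⟩
    rw [meanAvoid_succ, killed_zero]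
    refine le_trans ?_ le_add_self
    refine le_trans ?_ (Finset.single_le_sum (fun _ _ => zero_le) (Finset.mem_univ j))
    simp
  | succ y =>
    obtain ⟨i, hi⟩ := hpos (hC.col_P j)
    refine ⟨i, W.P i j, hi, fun T => ?_⟩
    rw [meanAvoid_succ, killed_succ]
    refine le_trans ?_ le_add_self
    refine le_trans ?_ (Finset.single_le_sum (fun _ _ => zero_le) (Finset.mem_univ j))
    rw [add_assoc]
    refine le_trans ?_ le_self_add
    simp

theorem LayerPositiveRecurrent.exists_truncatedDescent_bound {y : ℕ}
    (h : W.LayerPositiveRecurrent y) (hC : W.ConditionC) (j : Fin d) :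
    ∃ C : ℝ, ∀ T, W.truncatedDescent T 1 j ≤ C := by
  obtain ⟨i, c, hc, hasc⟩ := hC.exists_ascent y j
  obtain ⟨C, hC', hb⟩ := h.exists_bound W i
  refine ⟨C.toReal / c, fun T => ?_⟩
  rw [le_div_iff₀' hc]
  refine ENNReal.ofReal_le_iff_le_toReal hC'.ne |>.1 ?_
  rw [ENNReal.ofReal_mul hc.le]
  exact (mul_le_mul_right (W.ofReal_truncatedDescent_le y T 1 j) _).trans
    ((hasc T).trans (hb (T + 1)))

/-- The entrywise deficits `ζ - firstPassage T 1` are nonnegative, and each row of them sums to an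
increment of the convergent truncated means, hence tends to `0`. -/
theorem tendsto_firstPassage_one (h : W.IsExitMatrix ζ) (hC : W.ConditionC) {v : Fin d → ℝ}
    (hv : Filter.Tendsto (fun T => W.truncatedDescent T 1) Filter.atTop (nhds v)) :
    Filter.Tendsto (fun T => W.firstPassage T 1) Filter.atTop (nhds ζ) := by
  refine tendsto_pi_nhds.2 fun i => tendsto_pi_nhds.2 fun j => ?_
  have hle : ∀ T j, W.firstPassage T 1 i j ≤ ζ i j := fun T j => by
    simpa using firstPassage_le_pow h.nonneg (h.eq hC) T 1 i j
  have hlim : Filter.Tendsto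
      (fun T => ζ i j - (W.truncatedDescent (T + 1) 1 - W.truncatedDescent T 1) i)
      Filter.atTop (nhds (ζ i j)) := by
    have h1 := tendsto_pi_nhds.1 ((hv.comp (Filter.tendsto_add_atTop_nat 1)).sub hv) i
    simpa using h1.const_sub (ζ i j)
  refine tendsto_of_tendsto_of_tendsto_of_le_of_le hlim tendsto_const_nhds (fun T => ?_)
    fun T => hle T j
  have h1 := Finset.single_le_sum (f := fun j => ζ i j - W.firstPassage T 1 i j)
    (fun k _ => sub_nonneg.2 (hle T k)) (Finset.mem_univ j)
  have h2 := congrFun (W.firstPassage_mulVec_one T 1) i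
  rw [Finset.sum_sub_distrib, sum_row_eq_mulVec_one, sum_row_eq_mulVec_one, h.mulVec_one, h2] at h1
  simp only [Pi.sub_apply, Pi.one_apply] at h1 ⊢
  linarith

theorem IsExitMatrix.rhoBar_lt_top (h : W.IsExitMatrix ζ) (hC : W.ConditionC)
    (hb : ∀ j, ∃ C : ℝ, ∀ T, W.truncatedDescent T 1 j ≤ C) : W.rhoBar ζ < ∞ := by
  choose C hC' using hb
  have hmono : Monotone fun T => W.truncatedDescent T 1 := W.truncatedDescent_mono 1
  have hbdd : BddAbove (Set.range fun T => W.truncatedDescent T 1) :=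
    ⟨C, by rintro _ ⟨T, rfl⟩; exact fun j => hC' j T⟩
  obtain ⟨v, hv⟩ : ∃ v, Filter.Tendsto (fun T => W.truncatedDescent T 1) Filter.atTop (nhds v) :=
    ⟨_, tendsto_atTop_ciSup hmono hbdd⟩
  have hle : ∀ T, W.truncatedDescent T 1 ≤ v := hmono.ge_of_tendsto hv
  have hv0 : 0 ≤ v := hle 0
  have hF := tendsto_firstPassage_one h hC hv
  have key : 1 + W.P *ᵥ (v + ζ *ᵥ v) + W.R *ᵥ v ≤ v := by
    have hlim : Filter.Tendsto (fun T => 1 + W.P *ᵥ (W.truncatedDescent T 1 +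
        W.firstPassage T 1 *ᵥ W.truncatedDescent T 1) + W.R *ᵥ W.truncatedDescent T 1)
        Filter.atTop (nhds (1 + W.P *ᵥ (v + ζ *ᵥ v) + W.R *ᵥ v)) :=
      ((tendsto_mulVec tendsto_const_nhds (hv.add (tendsto_mulVec hF hv))).const_add 1).add
        (tendsto_mulVec tendsto_const_nhds hv)
    -- One step, then horizon `T` for each of the two layers to descend after a move up.
    refine le_of_tendsto' hlim fun T => (?_ : _ ≤ W.truncatedDescent (T + T + 1) 1).trans (hle _)
    rw [truncatedDescent, truncatedDescent_layer_zero, mulVec_zero, add_zero]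
    exact add_le_add (add_le_add le_rfl
      (mulVec_mono_of_nonneg W.P_nonneg (W.truncatedDescent_add_le T T 1)))
      (mulVec_mono_of_nonneg W.R_nonneg (W.truncatedDescent_mono 1 (by omega)))
  -- Multiplying `key` by the nonnegative inverse of `I - Pζ - R` preserves the inequality;
  -- iterating the result from `0 ≤ v` bounds the partial sums.
  have hstep : W.uminus ζ + W.Aminus ζ *ᵥ v ≤ v := by
    have h1 : 1 + W.P *ᵥ v ≤ (1 - W.P * ζ - W.R) *ᵥ v := by
      intro i
      have := key i
      simp only [sub_mulVec, one_mulVec, ← mulVec_mulVec, mulVec_add, Pi.add_apply,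
        Pi.sub_apply] at this ⊢
      linarith
    have h2 := mulVec_mono_of_nonneg (h.inv_nonneg hC) h1
    rwa [mulVec_mulVec, h.inv_mul hC, one_mulVec, mulVec_add, mulVec_mulVec] at h2
  have hsum : ∀ n, ∑ k ∈ Finset.range n, (W.Aminus ζ ^ k) *ᵥ W.uminus ζ ≤ v := by
    intro n
    induction n with
    | zero => simpa using hv0
    | succ n ih =>
      refine le_trans (le_of_eq ?_)
        ((add_le_add_right (mulVec_mono_of_nonneg (h.Aminus_nonneg hC) ih) (W.uminus ζ)).trans
          hstep)
      rw [Finset.sum_range_succ', add_comm, mulVec_sum]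
      simp [pow_succ']
  refine hC.rhoBar_lt_top_iff.2 fun j => ?_
  rw [ENNReal.tsum_eq_iSup_nat]
  refine (iSup_le fun n => ?_).trans_lt (ENNReal.ofReal_lt_top (r := v j))
  rw [← ENNReal.ofReal_sum_of_nonneg fun k _ => h.Aminus_pow_mulVec_uminus_nonneg hC k j]
  refine ENNReal.ofReal_le_ofReal ?_
  simpa using hsum n j

end StripWalk

end

theorem corollary5 {d : ℕ} (hd : 0 < d) (W : StripWalk d) (hC : W.ConditionC) :
    (∃ ζ, W.IsExitMatrix ζ) ∧
    ∀ ζ, W.IsExitMatrix ζ →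
      (∀ y : ℕ, W.LayerPositiveRecurrent y ↔ W.rhoBar ζ < ∞) ∧
      ∃ r : ℝ, IsMaximalEigenvalue (W.Aminus ζ) r ∧ (W.rhoBar ζ < ∞ → r < 1) := by
  refine ⟨StripWalk.exists_isExitMatrix hd hC, fun ζ hζ =>
    ⟨fun y => ⟨fun h => ?_, fun h => ?_⟩, ?_⟩⟩
  · exact hζ.rhoBar_lt_top hC fun j => h.exists_truncatedDescent_bound hC j
  · exact hζ.layerPositiveRecurrent hC h y
  · obtain ⟨r, hr, -, x, hx, hrx⟩ := exists_isMaximalEigenvalue hd (hζ.Aminus_nonneg hC)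
    exact ⟨r, hr, fun hρ => hζ.eigenvalue_lt_one hC hρ hx hrx⟩
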